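/- Let $\mathbb H[q_1,q_2]$ be the ring of slice regular polynomials $P(q_1,q_2)=\sum_{n,m} q_1^nq_2^m a_{n,m}$, $a_{n,m}\in\mathbb H$, with the $*$-product, i.e. $(q_1^nq_2^ma)*(q_1^rq_2^sb)=q_1^{n+r}q_2^{m+s}ab$, extended additively. The regular conjugate of $P$ is $P^c=\sum q_1^nq_2^m\overline{a_{n,m}}$, and its symmetrization is $P^s=P*P^c$. Let $\mathcal L(\mathbb H)$ be the skew field of left $*$-quotients $f^{-*}*g$ of slice regular functions on $\mathbb H$ (everywhere convergent power series $\sum q^na_n$, with the $*$-product); it contains $\mathbb H[q]$. For a square matrix over $\mathcal L(\mathbb H)$ let $\mathrm{Det}^*$ be its Dieudonné determinant, with values in the abelianization of $\mathcal L(\mathbb H)\setminus\{0\}$ together with the class $[0]$, which is its value on singular matrices. For $P,Q\in\mathbb H[q_1,q_2]$ write $P=\sum_{k=0}^n q_1^k*P_k(q_2)$ and $Q=\sum_{k=0}^m q_1^k*Q_k(q_2)$ with $n=\deg_{q_1}P$, $m=\deg_{q_1}Q$ (the zero polynomial having degree $0$ here). The regular resultant $\mathrm{Res}(P,Q;q_1)$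 is $\mathrm{Det}^*$ of the $(n+m)\times(n+m)$ Sylvester matrix over $\mathbb H[q_2]\subset\mathcal L(\mathbb H)$ whose first $m$ columns are the successive downward shifts of $(P_0,\dots,P_n,0,\dots,0)^t$ and whose last $n$ columns are the successive downward shifts of $(Q_0,\dots,Q_m,0,\dots,0)^t$. The regular resultant $\mathrm{Res}(P,Q;q_2)$ is defined in the same way, writing $P$ and $Q$ as polynomials in $q_2$ with coefficients in $\mathbb H[q_1]$. **Corollary.** Let $P,Q\in\mathbb H[q_1,q_2]$. If $\mathrm{Res}(P,Q;q_1)\equiv 0$ (respectively $\mathrm{Res}(P,Q;q_2)\equiv 0$), then for every $I\in\mathbb H$ with $I^2=-1$ the restrictions of $P^s$ and $Q^s$ to the slice $\mathbb C_I=\mathbb R+\mathbb R I$ (i.e. to $(q_1,q_2)\in\mathbb C_I\times\mathbb C_I$) have a common factor in the polynomial ring $\mathbb C_I[q_1,q_2]$ of positive degree in $q_1$ (respectively in $q_2$). -/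

import Mathlib

open scoped Quaternion Polynomial PowerSeries nonZeroDivisors

noncomputable section

namespace SliceRegular

/-! ### Dieudonné determinant over a skew field -/

section Dieudonne

variable {F : Type*} [DivisionRing F]

/-- The maximal abelian quotient of the multiplicative group of a skew field `F`,
with the class `[0]` adjoined. -/
abbrev AbQuot (F : Type*) [DivisionRing F] : Type _ := WithZero (Abelianization Fˣ)

open Classical in
/-- The class `[x]` of `x : F`. -/
def cls (x : F) : AbQuot F :=
  if h : x = 0 then 0 else ((Abelianization.of (Units.mk0 x h) : Abelianization Fˣ) : AbQuot F)

/-- Subtract left multiples of row `k` from the other rows so that the other entries of column `0`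
vanish (assuming `A k 0 ≠ 0`); then delete row `k` and column `0`. -/
def eliminate {n : ℕ} (A : Matrix (Fin (n + 1)) (Fin (n + 1)) F) (k : Fin (n + 1)) :
    Matrix (Fin n) (Fin n) F :=
  fun i j => A (k.succAbove i) j.succ - A (k.succAbove i) 0 * (A k 0)⁻¹ * A k j.succ

open Classical in
/-- The Dieudonné determinant, extended by `[0]` to singular matrices, computed by elimination along
the first column with a chosen non-zero pivot. The sign `(-1) ^ k` makes it agree with the usual
determinant over every commutative field; over a skew field that contains the quaternions it is
invisible, since there `-1 = i * j * i⁻¹ * j⁻¹` has class `1`. -/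
def dieudonneDet : (n : ℕ) → Matrix (Fin n) (Fin n) F → AbQuot F
  | 0, _ => 1
  | n + 1, A =>
    if h : ∃ k, A k 0 ≠ 0 then
      cls ((-1) ^ (h.choose : ℕ) * A h.choose 0) * dieudonneDet n (eliminate A h.choose)
    else 0

end Dieudonne

/-! ### Slice regular functions on the quaternions and their skew field of quotients -/

lemma summable_iff (f : ℍ[ℝ]⟦X⟧) (q : ℍ[ℝ]) :
    Summable (fun n : ℕ => q ^ n * PowerSeries.coeff n f) ↔
      Summable (fun n : ℕ => ‖(‖q‖ ^ n : ℝ) • PowerSeries.coeff n f‖) := by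
  rw [← summable_norm_iff]
  simp [norm_smul, norm_mul]

/-- The ring `SR(ℍ)` of slice regular functions on all of `ℍ`: the power series `∑ qⁿ aₙ` with
quaternionic coefficients on the right that converge at every `q : ℍ`. Multiplication of power
series (in which the variable commutes with the coefficients) is the `*`-product. -/
def SR : Subring ℍ[ℝ]⟦X⟧ where
  carrier := {f | ∀ q : ℍ[ℝ], Summable fun n : ℕ => q ^ n * PowerSeries.coeff n f}
  mul_mem' := by
    intro f g hf hg q
    have hf := (summable_iff f q).1 (hf q)
    have hg := (summable_iff g q).1 (hg q)
    rw [summable_iff]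
    refine (summable_norm_sum_mul_antidiagonal_of_summable_norm hf hg).congr fun n => ?_
    congr 1
    rw [PowerSeries.coeff_mul, Finset.smul_sum]
    refine Finset.sum_congr rfl fun kl hkl => ?_
    rw [smul_mul_smul_comm, ← pow_add, Finset.HasAntidiagonal.mem_antidiagonal.1 hkl]
  one_mem' := by
    intro q
    refine summable_of_ne_finset_zero (s := {0}) fun n hn => ?_
    simp only [Finset.mem_singleton] at hn
    simp [PowerSeries.coeff_one, hn]
  add_mem' := by
    intro f g hf hg q
    simpa [mul_add] using (hf q).add (hg q)
  zero_mem' := by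
    intro q
    simp
  neg_mem' := by
    intro f hf q
    simpa using (hf q).neg

/-- The regular conjugate `∑ qⁿ (conj aₙ)` of `∑ qⁿ aₙ`. -/
def conjSR (f : SR) : SR :=
  ⟨PowerSeries.mk fun n => star (PowerSeries.coeff n (f : ℍ[ℝ]⟦X⟧)), fun q => by
    have h := (summable_iff _ q).1 (f.2 q)
    rw [summable_iff]
    simpa [norm_smul] using h⟩

lemma conjSR_mul_self_comm (f g : SR) : conjSR f * f * g = g * (conjSR f * f) := by
  have hreal : ∀ n, ∃ x : ℝ,
      PowerSeries.coeff n ((conjSR f * f : SR) : ℍ[ℝ]⟦X⟧) = (x : ℍ[ℝ]) := by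
    intro n
    refine ⟨_, Quaternion.star_eq_self.1 ?_⟩
    simp only [Subring.coe_mul, PowerSeries.coeff_mul, star_sum, star_mul]
    rw [← Finset.Nat.sum_antidiagonal_swap]
    simp [conjSR]
  apply Subtype.ext
  ext1 n
  rw [Subring.coe_mul SR (conjSR f * f) g, Subring.coe_mul SR g (conjSR f * f), PowerSeries.coeff_mul, PowerSeries.coeff_mul,
    ← Finset.Nat.sum_antidiagonal_swap]
  refine Finset.sum_congr rfl fun kl _ => ?_
  obtain ⟨x, hx⟩ := hreal kl.2
  simp only [Prod.fst_swap, Prod.snd_swap, hx]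
  exact (Quaternion.coe_commutes x _)

lemma conjSR_ne_zero {f : SR} (hf : f ≠ 0) : conjSR f ≠ 0 := by
  intro h
  apply hf
  apply Subtype.ext
  ext1 n
  have := congrArg (fun g : SR => PowerSeries.coeff n (g : ℍ[ℝ]⟦X⟧)) h
  simpa [conjSR] using this

/-- `SR(ℍ)` is a left Ore domain. -/
instance instOreSetSR : OreLocalization.OreSet (SR⁰) :=
  OreLocalization.oreSetOfNoZeroDivisors
    (fun r s => r * conjSR s)
    (fun _ s => ⟨conjSR s * s, mem_nonZeroDivisors_of_ne_zero
      (mul_ne_zero (conjSR_ne_zero (nonZeroDivisors.ne_zero s.2)) (nonZeroDivisors.ne_zero s.2))⟩)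
    (fun r s => by
      change conjSR s * s * r = r * conjSR s * s
      rw [conjSR_mul_self_comm, mul_assoc])

/-- The skew field `L(ℍ)` of left `*`-quotients `f⁻* * g` of slice regular functions on `ℍ`. -/
abbrev L : Type := OreLocalization (SR⁰) SR

/-- A slice regular polynomial `∑ qⁿ aₙ` in one variable, as an element of `SR(ℍ)`. -/
def polyToSR (p : ℍ[ℝ][X]) : SR :=
  ⟨(p : ℍ[ℝ]⟦X⟧), fun q =>
    summable_of_ne_finset_zero (s := p.support) fun n hn => by
      simp [Polynomial.notMem_support_iff.1 hn]⟩

/-- A slice regular polynomial in one variable, as an element of `L(ℍ)`. -/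
def polyToL (p : ℍ[ℝ][X]) : L := OreLocalization.numeratorHom (polyToSR p)

/-! ### Slice regular polynomials in two variables -/

/-- Polynomials `∑ q₁ⁿ q₂ᵐ aₙₘ` in two variables `q₁`, `q₂`, which commute with each other and with
the coefficients: the coefficient of `q₁ⁿ q₂ᵐ` in `P` is `(P.coeff n).coeff m`. For `R = ℍ` this is
the ring of slice regular polynomials with the `*`-product. -/
abbrev Poly₂ (R : Type*) [Semiring R] : Type _ := R[X][X]

section Poly₂

variable {R : Type*} [Semiring R]

/-- The same polynomial, written as a polynomial in `q₂` whose coefficients are polynomials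
in `q₁`. -/
def swapVars (P : Poly₂ R) : Poly₂ R :=
  P.sum fun n p => p.sum fun m a => Polynomial.monomial m (Polynomial.monomial n a)

lemma coeff_swapVars (P : Poly₂ R) (n m : ℕ) :
    ((swapVars P).coeff m).coeff n = (P.coeff n).coeff m := by
  classical
  simp only [swapVars, Polynomial.sum_def, Polynomial.finsetSum_coeff, Polynomial.coeff_monomial]
  rw [Finset.sum_eq_single n]
  · rw [Finset.sum_eq_single m]
    · simp
    · intro b _ hb
      simp [hb]
    · intro h
      simp [Polynomial.notMem_support_iff.1 h]
  · intro b _ hb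
    refine Finset.sum_eq_zero fun k _ => ?_
    split_ifs <;> simp [Polynomial.coeff_monomial, hb]
  · intro h
    simp [Polynomial.notMem_support_iff.1 h]

/-- The degree in `q₁`. -/
def degQ₁ (P : Poly₂ R) : ℕ := P.natDegree

/-- The degree in `q₂`. -/
def degQ₂ (P : Poly₂ R) : ℕ := (swapVars P).natDegree

/-- The value `∑ q₁ⁿ q₂ᵐ aₙₘ`. -/
def evalAt (P : Poly₂ R) (q₁ q₂ : R) : R :=
  P.sum fun n p => p.sum fun m a => q₁ ^ n * q₂ ^ m * a

end Poly₂

/-- The regular conjugate `∑ q₁ⁿ q₂ᵐ (conj aₙₘ)`. -/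
def regConj (P : Poly₂ ℍ[ℝ]) : Poly₂ ℍ[ℝ] :=
  P.sum fun n p =>
    Polynomial.monomial n (p.sum fun m a => Polynomial.monomial m (star a))

lemma coeff_regConj (P : Poly₂ ℍ[ℝ]) (n m : ℕ) :
    ((regConj P).coeff n).coeff m = star ((P.coeff n).coeff m) := by
  classical
  simp only [regConj, Polynomial.sum_def, Polynomial.finsetSum_coeff, Polynomial.coeff_monomial]
  rw [Finset.sum_eq_single n]
  · rw [if_pos rfl, Polynomial.finsetSum_coeff, Finset.sum_eq_single m]
    · simp
    · intro b _ hb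
      simp [Polynomial.coeff_monomial, hb]
    · intro h
      simp [Polynomial.notMem_support_iff.1 h]
  · intro b _ hb
    simp [hb]
  · intro h
    simp [Polynomial.notMem_support_iff.1 h]

/-- The symmetrization `Pˢ = P * Pᶜ`. -/
def symmetrization (P : Poly₂ ℍ[ℝ]) : Poly₂ ℍ[ℝ] := P * regConj P

/-! ### Regular resultants -/

/-- The regular resultant `Res(P, Q; q₁)`: the Dieudonné determinant over `L(ℍ)` of the Sylvester
matrix of `P` and `Q` as polynomials in `q₁` with coefficients in `ℍ[q₂]`. With `n` and `m` the
degrees of `P` and `Q` in `q₁`, its first `m` columns hold the shifted coefficients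
`P₀, …, Pₙ`, and its last `n` columns the shifted coefficients `Q₀, …, Qₘ`. -/
def regResultant₁ (P Q : Poly₂ ℍ[ℝ]) : AbQuot L :=
  dieudonneDet (degQ₁ Q + degQ₁ P)
    ((Polynomial.sylvester Q P (degQ₁ Q) (degQ₁ P)).map polyToL)

/-- The regular resultant `Res(P, Q; q₂)`: the same with `P` and `Q` written as polynomials in `q₂`
with coefficients in `ℍ[q₁]`. -/
def regResultant₂ (P Q : Poly₂ ℍ[ℝ]) : AbQuot L :=
  dieudonneDet (degQ₂ Q + degQ₂ P)
    ((Polynomial.sylvester (swapVars Q) (swapVars P) (degQ₂ Q) (degQ₂ P)).map polyToL)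

/-! ### Slices -/

/-- The sphere of imaginary units. -/
abbrev ImaginaryUnit : Type := {I : ℍ[ℝ] // I ^ 2 = -1}

/-- The slice `ℂ_I = ℝ + ℝ I`. -/
def slice (I : ImaginaryUnit) : Subring ℍ[ℝ] where
  carrier := {q | ∃ x y : ℝ, q = (x : ℍ[ℝ]) + (y : ℍ[ℝ]) * I.1}
  mul_mem' := by
    rintro _ _ ⟨a, b, rfl⟩ ⟨c, d, rfl⟩
    refine ⟨a * c - b * d, a * d + b * c, ?_⟩
    have hI : I.1 * I.1 = -1 := by rw [← sq]; exact I.2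
    have h1 : I.1 * (c : ℍ[ℝ]) = c * I.1 := (Quaternion.coe_commutes c I.1).symm
    have h2 : I.1 * ((d : ℍ[ℝ]) * I.1) = -(d : ℍ[ℝ]) := by
      rw [← mul_assoc, ← Quaternion.coe_commutes d I.1, mul_assoc, hI, mul_neg_one]
    have h3 : ((a : ℍ[ℝ]) + b * I.1) * (c + d * I.1)
        = a * c + a * (d * I.1) + b * (I.1 * c) + b * (I.1 * (d * I.1)) := by noncomm_ring
    rw [h3, h1, h2]
    push_cast
    noncomm_ring
  one_mem' := ⟨1, 0, by simp⟩
  add_mem' := by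
    rintro _ _ ⟨a, b, rfl⟩ ⟨c, d, rfl⟩
    exact ⟨a + c, b + d, by push_cast; noncomm_ring⟩
  zero_mem' := ⟨0, 0, by simp⟩
  neg_mem' := by
    rintro _ ⟨a, b, rfl⟩
    exact ⟨-a, -b, by push_cast; noncomm_ring⟩

/-- `D`, a polynomial in two variables with coefficients in `ℂ_I`, is a factor in `ℂ_I[z₁, z₂]` of
the restriction of `P` to `ℂ_I`, that is, to the points `(z₁, z₂)` with `z₁, z₂ ∈ ℂ_I`. -/
def IsFactorOnSlice (I : ImaginaryUnit) (D : Poly₂ (slice I)) (P : Poly₂ ℍ[ℝ]) : Prop :=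
  ∃ E : Poly₂ (slice I), ∀ z₁ z₂ : slice I,
    evalAt P (z₁ : ℍ[ℝ]) (z₂ : ℍ[ℝ]) =
      ((evalAt D z₁ z₂ * evalAt E z₁ z₂ : slice I) : ℍ[ℝ])

end SliceRegular

end

noncomputable section

namespace SliceRegular

open Polynomial

/-! ### Singular matrices over a skew field -/

section Dieudonne

variable {F : Type*} [DivisionRing F]

/-! A vanishing Dieudonné determinant gives the Sylvester matrix a nonzero right kernel vector over
`L`. Multiplying by a central slice regular function clears its denominators
(`exists_kernel_of_dieudonneDet_eq_zero`). The resulting power series in `q₂` are the coefficients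
of a nontrivial relation `P * U + Q * V = 0` in `ℍ⟦q₂⟧[q₁]`, where `U` and `V`, when nonzero, have
degree less than `Q` and `P` respectively.

Symmetrization is multiplicative with central values and doubles degrees, so `Pˢ Uˢ = Qˢ Vˢ`. The
polynomials `Pˢ`, `Qˢ` are real. If their ordinary resultant `c` over `ℝ[q₂]` were nonzero, a Bézout
identity `Pˢ a + Qˢ b = c` would give `c Uˢ = Qˢ (a Vˢ + b Uˢ)`; for `U ≠ 0` this contradicts the
degree bound, and likewise for `V` (`eq_zero_of_mul_add_mul_eq_zero`). Hence `c = 0`, and Gauss's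
lemma over the UFD `ℝ[q₂]` yields a real common factor of positive degree in `q₁`. Being real, it
serves on all slices at once. Exchanging the variables gives the statement for `q₂`. -/

lemma cls_ne_zero {x : F} (hx : x ≠ 0) : cls x ≠ 0 := by
  rw [cls, dif_neg hx]
  exact WithZero.coe_ne_zero

/-- A square matrix with vanishing Dieudonné determinant has a non-trivial right kernel. -/
theorem exists_mulVec_eq_zero_of_dieudonneDet_eq_zero :
    ∀ (n : ℕ) (A : Matrix (Fin n) (Fin n) F), dieudonneDet n A = 0 →
      ∃ w : Fin n → F, w ≠ 0 ∧ ∀ i, ∑ j, A i j * w j = 0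
  | 0, A, h => by simp [dieudonneDet] at h
  | n + 1, A, h => by
    rw [dieudonneDet] at h
    split_ifs at h with hk
    · generalize hk.choose = k, hk.choose_spec = hk0 at h
      rcases mul_eq_zero.1 h with h | h
      · exact absurd h (cls_ne_zero (mul_ne_zero (pow_ne_zero _ (by simp)) hk0))
      obtain ⟨w, hw, hA⟩ := exists_mulVec_eq_zero_of_dieudonneDet_eq_zero n _ h
      -- The head entry solves the equation of the pivot row `k`; substituting it into any other row
      -- leaves a row of `eliminate A k` applied to `w`.
      refine ⟨Fin.cons (-((A k 0)⁻¹ * ∑ j, A k j.succ * w j)) w, ?_, ?_⟩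
      · intro h0
        apply hw
        funext j
        simpa using congrFun h0 j.succ
      · intro i
        rw [Fin.sum_univ_succ]
        simp only [Fin.cons_zero, Fin.cons_succ]
        rcases Fin.eq_self_or_eq_succAbove k i with rfl | ⟨i, rfl⟩
        · rw [mul_neg, mul_inv_cancel_left₀ hk0, neg_add_cancel]
        · have h1 := hA i
          simp only [eliminate, sub_mul, Finset.sum_sub_distrib, sub_eq_zero] at h1
          rw [h1, mul_neg, Finset.mul_sum, Finset.mul_sum]
          simp [mul_assoc]
    · push Not at hk
      refine ⟨Pi.single 0 1, by simp, fun i => ?_⟩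
      rw [Finset.sum_eq_single 0] <;> simp +contextual [hk]

end Dieudonne

/-! ### Clearing denominators -/

lemma numeratorHom_injective :
    Function.Injective (OreLocalization.numeratorHom : SR → L) :=
  OreLocalization.numeratorHom_inj inf_le_left

/-- Every `*`-quotient becomes a slice regular function after multiplication by a central one. -/
lemma exists_central_mul_eq_numerator (x : L) :
    ∃ s : SR, s ≠ 0 ∧ (∀ g, s * g = g * s) ∧
      ∃ r : SR, OreLocalization.numeratorHom s * x = OreLocalization.numeratorHom r := by
  induction x using OreLocalization.ind with | _ r s =>
  have hs : (s : SR) ≠ 0 := nonZeroDivisors.ne_zero s.2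
  refine ⟨conjSR s * s, mul_ne_zero (conjSR_ne_zero hs) hs, conjSR_mul_self_comm s,
    conjSR s * r, ?_⟩
  rw [map_mul, map_mul, mul_assoc]
  congr 1
  rw [OreLocalization.numeratorHom_apply, OreLocalization.numeratorHom_apply,
    OreLocalization.mul_cancel]

/-- Products of central denominators are again central, so a finite family has a central common
denominator. -/
lemma exists_common_central_mul_eq_numerator {ι : Type*} (t : Finset ι) (w : ι → L) :
    ∃ s : SR, s ≠ 0 ∧ (∀ g, s * g = g * s) ∧
      ∀ j ∈ t, ∃ r : SR, OreLocalization.numeratorHom s * w j = OreLocalization.numeratorHom r := by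
  classical
  induction t using Finset.induction_on with
  | empty => exact ⟨1, one_ne_zero, by simp, by simp⟩
  | insert k t _ ih =>
    obtain ⟨s, hs, hc, h⟩ := ih
    obtain ⟨s', hs', hc', r', h'⟩ := exists_central_mul_eq_numerator (w k)
    refine ⟨s * s', mul_ne_zero hs hs', fun g => ?_, fun j hj => ?_⟩
    · rw [mul_assoc, hc', ← mul_assoc, hc, mul_assoc]
    · rcases Finset.mem_insert.1 hj with rfl | hj
      · exact ⟨s * r', by rw [map_mul, map_mul, mul_assoc, h']⟩
      · obtain ⟨r, hr⟩ := h j hj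
        exact ⟨s' * r, by rw [hc, map_mul, map_mul, mul_assoc, hr]⟩

/-- A singular matrix of slice regular polynomials has a non-trivial right kernel vector of
slice regular functions. -/
theorem exists_kernel_of_dieudonneDet_eq_zero {n : ℕ} (A : Matrix (Fin n) (Fin n) ℍ[ℝ][X])
    (h : dieudonneDet n (A.map polyToL) = 0) :
    ∃ u : Fin n → ℍ[ℝ]⟦X⟧, u ≠ 0 ∧ ∀ i, ∑ j, (A i j : ℍ[ℝ]⟦X⟧) * u j = 0 := by
  obtain ⟨w, hw, hA⟩ := exists_mulVec_eq_zero_of_dieudonneDet_eq_zero n _ h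
  obtain ⟨s, hs, hc, hr⟩ := exists_common_central_mul_eq_numerator Finset.univ w
  choose u hu using fun j => hr j (Finset.mem_univ j)
  have hs' : (OreLocalization.numeratorHom s : L) ≠ 0 := by
    intro h0
    exact hs (numeratorHom_injective (h0.trans (map_zero OreLocalization.numeratorRingHom).symm))
  refine ⟨fun j => u j, fun h0 => hw ?_, fun i => ?_⟩
  · funext j
    have h1 : u j = 0 := Subtype.ext (congrFun h0 j)
    have h2 := hu j
    rw [h1, show (OreLocalization.numeratorHom (0 : SR) : L) = 0 from
      map_zero OreLocalization.numeratorRingHom] at h2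
    exact (mul_eq_zero.1 h2).resolve_left hs'
  · have h1 : ∑ j, polyToSR (A i j) * u j = 0 := by
      apply numeratorHom_injective
      change OreLocalization.numeratorRingHom _ = OreLocalization.numeratorRingHom _
      rw [map_sum, map_zero, ← mul_zero (OreLocalization.numeratorHom s : L), ← hA i,
        Finset.mul_sum]
      refine Finset.sum_congr rfl fun j _ => ?_
      change OreLocalization.numeratorHom _ = _
      -- Centrality of `s` is essential: the entries of `A` multiply from the left, and `s` has to
      -- move past them.
      rw [map_mul, ← hu j, ← mul_assoc, ← map_mul, ← hc, map_mul, mul_assoc]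
      rfl
    have h2 := congrArg (SR.subtype) h1
    rw [map_sum, map_zero] at h2
    exact h2

/-! ### Conjugation of polynomials over `ℍ⟦X⟧` -/

/-- Coefficientwise conjugation of power series. -/
def psConj : ℍ[ℝ]⟦X⟧ →+* ℍ[ℝ]⟦X⟧ᵐᵒᵖ where
  toFun f := .op (PowerSeries.mk fun n => star (PowerSeries.coeff n f))
  map_one' := by
    apply MulOpposite.unop_injective
    ext1 n
    simp only [MulOpposite.unop_op, MulOpposite.unop_one, PowerSeries.coeff_mk,
      PowerSeries.coeff_one]
    split_ifs <;> simp
  map_zero' := by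
    apply MulOpposite.unop_injective
    ext1 n
    simp
  map_add' f g := by
    apply MulOpposite.unop_injective
    ext1 n
    simp
  map_mul' f g := by
    apply MulOpposite.unop_injective
    ext1 n
    simp only [MulOpposite.unop_op, MulOpposite.unop_mul, PowerSeries.coeff_mk,
      PowerSeries.coeff_mul, star_sum, star_mul]
    rw [← Finset.Nat.sum_antidiagonal_swap]
    rfl

/-- Coefficientwise conjugation of polynomials over `ℍ⟦X⟧`. -/
def conj : ℍ[ℝ]⟦X⟧[X] →+* ℍ[ℝ]⟦X⟧[X]ᵐᵒᵖ :=
  ((opRingEquiv ℍ[ℝ]⟦X⟧).symm : ℍ[ℝ]⟦X⟧ᵐᵒᵖ[X] →+* ℍ[ℝ]⟦X⟧[X]ᵐᵒᵖ).comp (mapRingHom psConj)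

lemma coeff_conj (F : ℍ[ℝ]⟦X⟧[X]) (n m : ℕ) :
    PowerSeries.coeff m ((conj F).unop.coeff n) = star (PowerSeries.coeff m (F.coeff n)) := by
  have h : (opRingEquiv ℍ[ℝ]⟦X⟧) (conj F) = mapRingHom psConj F :=
    (opRingEquiv ℍ[ℝ]⟦X⟧).apply_symm_apply _
  have h2 := congrArg (fun p => MulOpposite.unop (coeff p n)) h
  simp only [coeff_opRingEquiv, coe_mapRingHom, coeff_map, MulOpposite.unop_op] at h2
  rw [h2]
  simp [psConj]

lemma ext_coeff {F G : ℍ[ℝ]⟦X⟧[X]}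
    (h : ∀ n m, PowerSeries.coeff m (F.coeff n) = PowerSeries.coeff m (G.coeff n)) : F = G := by
  ext n m : 2
  exact h n m

lemma unop_conj_conj (F : ℍ[ℝ]⟦X⟧[X]) : (conj (conj F).unop).unop = F :=
  ext_coeff fun n m => by simp [coeff_conj]

lemma unop_conj_mul (F G : ℍ[ℝ]⟦X⟧[X]) :
    (conj (F * G)).unop = (conj G).unop * (conj F).unop := by
  rw [map_mul, MulOpposite.unop_mul]

lemma unop_conj_eq_zero {F : ℍ[ℝ]⟦X⟧[X]} : (conj F).unop = 0 ↔ F = 0 := by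
  refine ⟨fun h => ?_, fun h => by simp [h]⟩
  rw [← unop_conj_conj F, h, map_zero, MulOpposite.unop_zero]

lemma natDegree_unop_conj_le (F : ℍ[ℝ]⟦X⟧[X]) : (conj F).unop.natDegree ≤ F.natDegree := by
  refine natDegree_le_iff_coeff_eq_zero.2 fun n hn => ?_
  ext1 m
  rw [coeff_conj, coeff_eq_zero_of_natDegree_lt hn]
  simp

lemma natDegree_unop_conj (F : ℍ[ℝ]⟦X⟧[X]) : (conj F).unop.natDegree = F.natDegree :=
  (natDegree_unop_conj_le F).antisymm <| by
    conv_lhs => rw [← unop_conj_conj F]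
    exact natDegree_unop_conj_le _

lemma commute_of_commute_coeff {R : Type*} [Semiring R] {f g : R[X]}
    (h : ∀ i j, Commute (f.coeff i) (g.coeff j)) : Commute f g := by
  ext1 n
  rw [coeff_mul, coeff_mul, ← Finset.Nat.sum_antidiagonal_swap]
  exact Finset.sum_congr rfl fun kl _ => h _ _

lemma _root_.PowerSeries.commute_of_commute_coeff {R : Type*} [Semiring R] {f g : R⟦X⟧}
    (h : ∀ i j, Commute (PowerSeries.coeff i f) (PowerSeries.coeff j g)) : Commute f g := by
  ext1 n
  rw [PowerSeries.coeff_mul, PowerSeries.coeff_mul, ← Finset.Nat.sum_antidiagonal_swap]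
  exact Finset.sum_congr rfl fun kl _ => h _ _

/-- Self-conjugate elements are central. -/
lemma commute_of_conj_eq {F : ℍ[ℝ]⟦X⟧[X]} (h : (conj F).unop = F) (G : ℍ[ℝ]⟦X⟧[X]) :
    Commute F G := by
  refine commute_of_commute_coeff fun i j => PowerSeries.commute_of_commute_coeff fun k l => ?_
  have h1 : star (PowerSeries.coeff k (F.coeff i)) = PowerSeries.coeff k (F.coeff i) := by
    rw [← coeff_conj, h]
  rw [Quaternion.star_eq_self.1 h1]
  exact Quaternion.coe_commutes _ _

/-- The symmetrization of a polynomial over `ℍ⟦X⟧`. -/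
def psSymm (F : ℍ[ℝ]⟦X⟧[X]) : ℍ[ℝ]⟦X⟧[X] := F * (conj F).unop

lemma conj_psSymm (F : ℍ[ℝ]⟦X⟧[X]) : (conj (psSymm F)).unop = psSymm F := by
  rw [psSymm, unop_conj_mul, unop_conj_conj]

/-- The inner factor of `F * (G * Gᶜ) * Fᶜ` is self-conjugate, hence central, and can be moved past
`Fᶜ`. -/
lemma psSymm_mul (F G : ℍ[ℝ]⟦X⟧[X]) : psSymm (F * G) = psSymm F * psSymm G := by
  have h := commute_of_conj_eq (conj_psSymm G) (conj F).unop
  unfold Commute SemiconjBy at h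
  rw [psSymm, unop_conj_mul, mul_assoc, ← mul_assoc G, ← psSymm, h, ← mul_assoc]
  rfl

lemma psSymm_neg (F : ℍ[ℝ]⟦X⟧[X]) : psSymm (-F) = psSymm F := by
  rw [psSymm, map_neg, MulOpposite.unop_neg]
  exact neg_mul_neg F _

lemma psSymm_ne_zero {F : ℍ[ℝ]⟦X⟧[X]} (h : F ≠ 0) : psSymm F ≠ 0 :=
  mul_ne_zero h (mt unop_conj_eq_zero.1 h)

lemma natDegree_psSymm (F : ℍ[ℝ]⟦X⟧[X]) : (psSymm F).natDegree = 2 * F.natDegree := by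
  rcases eq_or_ne F 0 with rfl | h
  · simp [psSymm]
  · rw [psSymm, natDegree_mul h (mt unop_conj_eq_zero.1 h), natDegree_unop_conj, two_mul]

/-! ### Real polynomials -/

/-- The inclusion of `ℝ[q₁, q₂]` into `ℍ[q₁, q₂]`. -/
def ofRealPoly : ℝ[X][X] →+* Poly₂ ℍ[ℝ] := mapRingHom (mapRingHom (algebraMap ℝ ℍ[ℝ]))

/-- The inclusion of `ℍ[q₁, q₂]` into the polynomials in `q₁` over `ℍ⟦X⟧`. -/
def toPS : Poly₂ ℍ[ℝ] →+* ℍ[ℝ]⟦X⟧[X] := mapRingHom coeToPowerSeries.ringHom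

lemma coeff_ofRealPoly (p : ℝ[X][X]) (n m : ℕ) :
    ((ofRealPoly p).coeff n).coeff m = ((p.coeff n).coeff m : ℍ[ℝ]) := by
  simp [ofRealPoly]

lemma coeff_toPS (P : Poly₂ ℍ[ℝ]) (n m : ℕ) :
    PowerSeries.coeff m ((toPS P).coeff n) = (P.coeff n).coeff m := by
  simp [toPS]

lemma toPS_injective : Function.Injective toPS := fun P Q h => by
  ext n m : 2
  rw [← coeff_toPS, h, coeff_toPS]

lemma ofRealPoly_injective : Function.Injective ofRealPoly := fun p q h => by
  ext n m
  have := congrArg (fun P : Poly₂ ℍ[ℝ] => (P.coeff n).coeff m) h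
  simpa [coeff_ofRealPoly] using this

lemma natDegree_toPS (P : Poly₂ ℍ[ℝ]) : (toPS P).natDegree = P.natDegree :=
  natDegree_map_eq_of_injective (Polynomial.coe_injective _) P

lemma natDegree_ofRealPoly (p : ℝ[X][X]) : (ofRealPoly p).natDegree = p.natDegree :=
  natDegree_map_eq_of_injective
    (map_injective _ (algebraMap ℝ ℍ[ℝ]).injective) p

lemma toPS_symmetrization (P : Poly₂ ℍ[ℝ]) : toPS (symmetrization P) = psSymm (toPS P) := by
  rw [symmetrization, map_mul, psSymm]
  congr 1
  exact ext_coeff fun n m => by rw [coeff_toPS, coeff_regConj, coeff_conj, coeff_toPS]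

lemma conj_toPS_ofRealPoly (p : ℝ[X][X]) :
    (conj (toPS (ofRealPoly p))).unop = toPS (ofRealPoly p) :=
  ext_coeff fun n m => by simp [coeff_conj, coeff_toPS, coeff_ofRealPoly]

/-- The symmetrization of a slice regular polynomial has real coefficients. -/
lemma exists_ofRealPoly_eq_symmetrization (P : Poly₂ ℍ[ℝ]) :
    ∃ p, ofRealPoly p = symmetrization P := by
  suffices h : symmetrization P ∈ lifts (mapRingHom (algebraMap ℝ ℍ[ℝ])) from
    (mem_lifts _).1 h
  refine (lifts_iff_coeff_lifts _).2 fun n => ?_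
  suffices h : (symmetrization P).coeff n ∈ lifts (algebraMap ℝ ℍ[ℝ]) from
    (mem_lifts _).1 h
  refine (lifts_iff_coeff_lifts _).2 fun m => ⟨_, (Quaternion.star_eq_self.1 ?_).symm⟩
  rw [← coeff_toPS, ← coeff_conj, toPS_symmetrization, conj_psSymm]

lemma natDegree_symmetrization (P : Poly₂ ℍ[ℝ]) :
    (symmetrization P).natDegree = 2 * P.natDegree := by
  rw [← natDegree_toPS, toPS_symmetrization, natDegree_psSymm, natDegree_toPS]

/-- If `p a + q b = c ≠ 0` with `c` of degree zero, and `p`, `q` are the symmetrizations of `P`,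
`Q`, then `P * U + Q * V = 0` with `U` of degree less than that of `Q` forces `U = 0`. -/
lemma eq_zero_of_mul_add_mul_eq_zero {P Q : Poly₂ ℍ[ℝ]} {p q a b : ℝ[X][X]} {c : ℝ[X]}
    (hp : ofRealPoly p = symmetrization P) (hq : ofRealPoly q = symmetrization Q)
    (hc : c ≠ 0) (h : p * a + q * b = C c) {U V : ℍ[ℝ]⟦X⟧[X]}
    (hUV : toPS P * U + toPS Q * V = 0) (hU : U = 0 ∨ U.natDegree < Q.natDegree) : U = 0 := by
  by_contra hU0
  replace hU := hU.resolve_left hU0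
  let ι : ℝ[X][X] →+* ℍ[ℝ]⟦X⟧[X] := toPS.comp ofRealPoly
  have hι (x : ℝ[X][X]) (G) : ι x * G = G * ι x :=
    commute_of_conj_eq (conj_toPS_ofRealPoly x) G
  have h1 : ι p * psSymm U = ι q * psSymm V := by
    -- The sign in `P * U = -(Q * V)` disappears under symmetrization.
    have := congrArg psSymm (eq_neg_of_add_eq_zero_left hUV)
    rw [psSymm_neg, psSymm_mul, psSymm_mul] at this
    simpa only [ι, RingHom.comp_apply, hp, hq, toPS_symmetrization] using this
  have h2 : ι (C c) * psSymm U = ι q * (ι a * psSymm V + ι b * psSymm U) := by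
    rw [← h, map_add, map_mul, map_mul, hι p, add_mul, mul_assoc, h1, mul_add, ← mul_assoc,
      ← mul_assoc, ← mul_assoc, hι a]
  have hιinj : Function.Injective ι := toPS_injective.comp ofRealPoly_injective
  have hC : ι (C c) ≠ 0 := by
    rw [Ne, map_eq_zero_iff ι hιinj, C_eq_zero]
    exact hc
  have hdeg (x) : (ι x).natDegree = x.natDegree := by
    rw [RingHom.comp_apply, natDegree_toPS, natDegree_ofRealPoly]
  have h3 := mul_ne_zero hC (psSymm_ne_zero hU0)
  -- The left side has degree `2 * U.natDegree`, while the right side, a nonzero multiple of `ι q`,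
  -- has degree at least `2 * Q.natDegree`.
  have h4 := congrArg natDegree h2
  rw [natDegree_mul hC (psSymm_ne_zero hU0), hdeg, natDegree_C, natDegree_psSymm] at h4
  rw [h2] at h3
  rw [natDegree_mul (left_ne_zero_of_mul h3) (right_ne_zero_of_mul h3), hdeg,
    ← natDegree_ofRealPoly, hq, natDegree_symmetrization] at h4
  omega

/-! ### Resultants and common factors over `ℝ[X]` -/

/-- Polynomials over a UFD with vanishing resultant have a common factor of positive degree. -/
lemma exists_common_factor_of_resultant_eq_zero {R : Type*} [CommRing R] [IsDomain R]
    [UniqueFactorizationMonoid R] {p q : R[X]} (h : resultant p q = 0) :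
    ∃ d, 0 < d.natDegree ∧ d ∣ p ∧ d ∣ q := by
  classical
  let K := FractionRing R
  have hinj : Function.Injective (algebraMap R K) := IsFractionRing.injective R K
  have h1 : resultant (p.map (algebraMap R K)) (q.map (algebraMap R K)) = 0 := by
    rw [natDegree_map_eq_of_injective hinj, natDegree_map_eq_of_injective hinj,
      resultant_map_map, h, map_zero]
  obtain ⟨hne, hcop⟩ := resultant_eq_zero_iff.1 h1
  set g := EuclideanDomain.gcd (p.map (algebraMap R K)) (q.map (algebraMap R K)) with hg
  have hg0 : g ≠ 0 := by
    rw [hg, Ne, EuclideanDomain.gcd_eq_zero_iff]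
    tauto
  have hgu : ¬ IsUnit g := by rwa [EuclideanDomain.gcd_isUnit_iff]
  -- Clearing denominators in the gcd over the fraction field and taking the primitive part gives
  -- the factor: Gauss's lemma brings divisibility back to `R[X]`.
  obtain ⟨b, hb, hbg⟩ := IsLocalization.integerNormalization_spec R⁰ g
  set g' := IsLocalization.integerNormalization R⁰ g
  have := (inferInstance : Nonempty (NormalizedGCDMonoid R)).some
  have hb0 : algebraMap R K b ≠ 0 := by
    rw [Ne, map_eq_zero_iff _ hinj]
    exact nonZeroDivisors.ne_zero hb
  have hbg' : g'.map (algebraMap R K) = C (algebraMap R K b) * g := by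
    rw [hbg, ← algebraMap_smul K b g, smul_eq_C_mul]
  have hdvd {r : R[X]} (hr : g ∣ r.map (algebraMap R K)) : g'.primPart ∣ r := by
    refine (isPrimitive_primPart g').dvd_of_fraction_map_dvd_fraction_map (K := K) ?_
    refine (Polynomial.map_dvd _ (primPart_dvd g')).trans ?_
    rw [hbg']
    exact (isUnit_C.2 hb0.isUnit).mul_left_dvd.2 hr
  refine ⟨g'.primPart, ?_, hdvd (EuclideanDomain.gcd_dvd_left _ _),
    hdvd (EuclideanDomain.gcd_dvd_right _ _)⟩
  rw [natDegree_primPart, ← natDegree_map_eq_of_injective hinj, hbg', natDegree_C_mul hb0]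
  exact natDegree_pos_iff_degree_pos.2 (degree_pos_of_ne_zero_of_nonunit hg0 hgu)

/-! ### The Sylvester matrix -/

/-- A kernel vector of the Sylvester matrix is a relation `P * U + Q * V = 0`. -/
lemma exists_mul_add_mul_eq_zero_of_regResultant₁_eq_zero {P Q : Poly₂ ℍ[ℝ]}
    (h : regResultant₁ P Q = 0) :
    ∃ U V : ℍ[ℝ]⟦X⟧[X], toPS P * U + toPS Q * V = 0 ∧
      (U = 0 ∨ U.natDegree < Q.natDegree) ∧ (V = 0 ∨ V.natDegree < P.natDegree) ∧
      ¬ (U = 0 ∧ V = 0) := by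
  obtain ⟨u, hu, hA⟩ := exists_kernel_of_dieudonneDet_eq_zero
    (sylvester Q P Q.natDegree P.natDegree) h
  -- The zero alternative is needed: the zero polynomial has `natDegree` 0, which is not less than
  -- `k` when `k = 0`.
  have hdeg (k : ℕ) (f : Fin k → ℍ[ℝ]⟦X⟧) :
      (∑ j : Fin k, monomial (j : ℕ) (f j)) = 0 ∨ (∑ j : Fin k, monomial (j : ℕ) (f j)).natDegree < k := by
    refine or_iff_not_imp_left.2 fun h0 => (natDegree_lt_iff_degree_lt h0).2 ?_
    refine (degree_sum_le _ _).trans_lt ?_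
    rw [Finset.sup_lt_iff (WithBot.bot_lt_coe _)]
    exact fun j _ => (degree_monomial_le _ _).trans_lt (by exact_mod_cast j.2)
  have hcoeff (k : ℕ) (f : Fin k → ℍ[ℝ]⟦X⟧) (j : Fin k) :
      (∑ i : Fin k, monomial (i : ℕ) (f i)).coeff j = f j := by
    simp [finsetSum_coeff, coeff_monomial, Fin.val_inj]
  -- Row `i` of a Sylvester block computes the coefficient of `q₁ ^ i` in a product; the window `[j,
  -- j + n]` loses nothing, since `S` has degree at most `n`.
  have hmul (k n : ℕ) (f : Fin k → ℍ[ℝ]⟦X⟧) (S : Poly₂ ℍ[ℝ]) (hS : S.natDegree ≤ n) (i : ℕ) :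
      (toPS S * ∑ j : Fin k, monomial (j : ℕ) (f j)).coeff i =
        ∑ j : Fin k, (((if i ∈ Set.Icc (j : ℕ) (j + n) then S.coeff (i - j) else 0 : ℍ[ℝ][X]) :
          ℍ[ℝ]⟦X⟧) * f j) := by
    rw [Finset.mul_sum, finsetSum_coeff]
    refine Finset.sum_congr rfl fun j _ => ?_
    rw [← C_mul_X_pow_eq_monomial, ← mul_assoc, coeff_mul_X_pow']
    simp only [coeff_mul_C, Set.mem_Icc]
    by_cases h1 : (j : ℕ) ≤ i
    · by_cases h2 : i ≤ j + n
      · simp [h1, h2, toPS]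
      · rw [if_pos h1, if_neg (by tauto), toPS, coe_mapRingHom, coeff_map,
          coeff_eq_zero_of_natDegree_lt (by omega)]
        simp
    · simp [h1]
  refine ⟨∑ j : Fin Q.natDegree, monomial (j : ℕ) (u (Fin.castAdd _ j)),
    ∑ j : Fin P.natDegree, monomial (j : ℕ) (u (Fin.natAdd _ j)), ?_, hdeg _ _, hdeg _ _, ?_⟩
  · ext1 i
    rw [coeff_add, hmul _ P.natDegree _ _ le_rfl, hmul _ Q.natDegree _ _ le_rfl, coeff_zero]
    by_cases hi : i < Q.natDegree + P.natDegree
    · have := hA ⟨i, hi⟩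
      rw [Fin.sum_univ_add] at this
      simpa only [sylvester, Matrix.of_apply, Fin.addCases_left, Fin.addCases_right] using this
    · have h1 (j : Fin Q.natDegree) : ¬ i ∈ Set.Icc (j : ℕ) (j + P.natDegree) := by
        rw [Set.mem_Icc]; omega
      have h2 (j : Fin P.natDegree) : ¬ i ∈ Set.Icc (j : ℕ) (j + Q.natDegree) := by
        rw [Set.mem_Icc]; omega
      simp [h1, h2]
  · rintro ⟨hU, hV⟩
    apply hu
    funext j
    induction j using Fin.addCases with
    | left j => exact (hcoeff _ (fun j => u (Fin.castAdd _ j)) j).symm.trans (by rw [hU]; rfl)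
    | right j => exact (hcoeff _ (fun j => u (Fin.natAdd _ j)) j).symm.trans (by rw [hV]; rfl)

/-- If the regular resultant vanishes, the symmetrizations have a common real factor of positive
degree in `q₁`. -/
theorem exists_real_common_factor {P Q : Poly₂ ℍ[ℝ]} (h : regResultant₁ P Q = 0) :
    ∃ d p q : ℝ[X][X], 0 < d.natDegree ∧ d ∣ p ∧ d ∣ q ∧
      ofRealPoly p = symmetrization P ∧ ofRealPoly q = symmetrization Q := by
  obtain ⟨U, V, hUV, hU, hV, hne⟩ := exists_mul_add_mul_eq_zero_of_regResultant₁_eq_zero h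
  obtain ⟨p, hp⟩ := exists_ofRealPoly_eq_symmetrization P
  obtain ⟨q, hq⟩ := exists_ofRealPoly_eq_symmetrization Q
  have hpd : p.natDegree = 2 * P.natDegree := by
    rw [← natDegree_ofRealPoly, hp, natDegree_symmetrization]
  have hqd : q.natDegree = 2 * Q.natDegree := by
    rw [← natDegree_ofRealPoly, hq, natDegree_symmetrization]
  have hres : resultant p q = 0 := by
    by_contra hc
    obtain ⟨a, b, -, -, hab⟩ := exists_mul_add_mul_eq_C_resultant p q le_rfl le_rfl <| by
      -- The Bézout identity needs a positive degree in `q₁`; if both degrees were zero, the bounds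
      -- would force `U = V = 0`.
      by_contra! h0
      exact hne ⟨hU.resolve_right (by omega), hV.resolve_right (by omega)⟩
    refine hne ⟨eq_zero_of_mul_add_mul_eq_zero hp hq hc hab hUV hU,
      eq_zero_of_mul_add_mul_eq_zero hq hp hc ((add_comm _ _).trans hab)
        ((add_comm _ _).trans hUV) hV⟩
  obtain ⟨d, hd, hdp, hdq⟩ := exists_common_factor_of_resultant_eq_zero hres
  exact ⟨d, p, q, hd, hdp, hdq, hp, hq⟩

/-! ### Evaluation on slices -/

/-- The inclusion of `ℝ` into a slice. -/
def realToSlice (I : ImaginaryUnit) : ℝ →+* slice I :=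
  (algebraMap ℝ ℍ[ℝ]).codRestrict (slice I) fun x => ⟨x, 0, by simp⟩

/-- A real polynomial as a polynomial over a slice. -/
def toSlicePoly (I : ImaginaryUnit) : ℝ[X][X] →+* Poly₂ (slice I) :=
  mapRingHom (mapRingHom (realToSlice I))

lemma coeff_toSlicePoly (I : ImaginaryUnit) (d : ℝ[X][X]) (n m : ℕ) :
    ((toSlicePoly I d).coeff n).coeff m = realToSlice I ((d.coeff n).coeff m) := by
  simp [toSlicePoly]

lemma toSlicePoly_map_injective (I : ImaginaryUnit) :
    Function.Injective (mapRingHom (realToSlice I)) :=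
  map_injective _ (realToSlice I).injective

lemma natDegree_toSlicePoly (I : ImaginaryUnit) (d : ℝ[X][X]) :
    (toSlicePoly I d).natDegree = d.natDegree :=
  natDegree_map_eq_of_injective (toSlicePoly_map_injective I) d

lemma commute_of_mem_slice {I : ImaginaryUnit} (z w : slice I) : Commute (z : ℍ[ℝ]) w := by
  obtain ⟨_, a, b, rfl⟩ := z
  obtain ⟨_, c, d, rfl⟩ := w
  have hr (x : ℝ) (y : ℍ[ℝ]) : Commute (x : ℍ[ℝ]) y := Quaternion.coe_commutes x y
  exact (hr a _).add_left (((hr b _)).mul_left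
    (((hr c _).symm).add_right (((hr d _).symm).mul_right (Commute.refl _))))

/-- Evaluation of real polynomials at commuting quaternions, as a ring homomorphism. -/
def realEval (z w : ℍ[ℝ]) (h : Commute z w) : ℝ[X][X] →+* ℍ[ℝ] :=
  eval₂RingHom' (aeval w : ℝ[X] →ₐ[ℝ] ℍ[ℝ]).toRingHom z fun a => by
    induction a using Polynomial.induction_on' with
    | add p q hp hq => rw [map_add]; exact hp.add_left hq
    | monomial n r =>
      simp only [AlgHom.toRingHom_eq_coe, RingHom.coe_coe, aeval_monomial]
      exact (show Commute _ z from Algebra.commutes r z).mul_left (h.symm.pow_left n)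

lemma realEval_apply (z w : ℍ[ℝ]) (h : Commute z w) (d : ℝ[X][X]) :
    realEval z w h d = d.sum fun n p => p.sum fun m a => z ^ n * w ^ m * (a : ℍ[ℝ]) := by
  change eval₂ _ z d = _
  rw [eval₂_eq_sum]
  refine Finset.sum_congr rfl fun n _ => ?_
  change aeval w (d.coeff n) * z ^ n = (d.coeff n).sum _
  rw [aeval_def, eval₂_eq_sum, sum_def, sum_def, Finset.sum_mul]
  refine Finset.sum_congr rfl fun m _ => ?_
  rw [mul_assoc, ← (h.pow_pow n m).eq]
  exact Quaternion.coe_commutes _ _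

lemma evalAt_ofRealPoly (z w : ℍ[ℝ]) (h : Commute z w) (d : ℝ[X][X]) :
    evalAt (ofRealPoly d) z w = realEval z w h d := by
  rw [realEval_apply]
  simp only [evalAt, ofRealPoly, coe_mapRingHom, sum_def, coeff_map,
    support_map_of_injective _ (algebraMap ℝ ℍ[ℝ]).injective,
    support_map_of_injective d (f := mapRingHom (algebraMap ℝ ℍ[ℝ]))
      (map_injective _ (algebraMap ℝ ℍ[ℝ]).injective)]
  rfl

lemma coe_evalAt_toSlicePoly {I : ImaginaryUnit} (z w : slice I) (d : ℝ[X][X]) :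
    ((evalAt (toSlicePoly I d) z w : slice I) : ℍ[ℝ]) = realEval z w (commute_of_mem_slice z w) d := by
  rw [realEval_apply]
  simp only [evalAt, toSlicePoly, coe_mapRingHom, sum_def, coeff_map,
    support_map_of_injective _ (realToSlice I).injective,
    support_map_of_injective d (f := mapRingHom (realToSlice I)) (toSlicePoly_map_injective I)]
  push_cast
  rfl

/-- Points of one slice commute, so evaluating real polynomials there is a ring homomorphism
(`realEval`) and respects the factorization. -/
lemma isFactorOnSlice_of_dvd (I : ImaginaryUnit) {d p : ℝ[X][X]} {P : Poly₂ ℍ[ℝ]} (h : d ∣ p)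
    (hp : ofRealPoly p = P) : IsFactorOnSlice I (toSlicePoly I d) P := by
  obtain ⟨e, rfl⟩ := h
  refine ⟨toSlicePoly I e, fun z w => ?_⟩
  rw [← hp, evalAt_ofRealPoly _ _ (commute_of_mem_slice z w), map_mul, Subring.coe_mul,
    coe_evalAt_toSlicePoly, coe_evalAt_toSlicePoly]

/-! ### Exchanging the variables -/

section Swap

variable {R : Type*} [Semiring R]

lemma poly₂_ext {P Q : Poly₂ R} (h : ∀ n m, (P.coeff n).coeff m = (Q.coeff n).coeff m) :
    P = Q := by
  ext n m
  exact h n m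

lemma swapVars_swapVars (P : Poly₂ R) : swapVars (swapVars P) = P :=
  poly₂_ext fun n m => by rw [coeff_swapVars, coeff_swapVars]

lemma swapVars_mul (P Q : Poly₂ R) : swapVars (P * Q) = swapVars P * swapVars Q :=
  poly₂_ext fun n m => by
    simp only [coeff_swapVars, coeff_mul, finsetSum_coeff]
    exact Finset.sum_comm

end Swap

lemma swapVars_dvd {d p : ℝ[X][X]} (h : d ∣ p) : swapVars d ∣ swapVars p := by
  obtain ⟨e, rfl⟩ := h
  exact ⟨swapVars e, swapVars_mul d e⟩

lemma swapVars_symmetrization (P : Poly₂ ℍ[ℝ]) :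
    swapVars (symmetrization (swapVars P)) = symmetrization P := by
  rw [symmetrization, swapVars_mul, swapVars_swapVars, symmetrization]
  congr 1
  exact poly₂_ext fun n m => by rw [coeff_swapVars, coeff_regConj, coeff_regConj, coeff_swapVars]

lemma ofRealPoly_swapVars (p : ℝ[X][X]) : ofRealPoly (swapVars p) = swapVars (ofRealPoly p) :=
  poly₂_ext fun n m => by simp only [coeff_ofRealPoly, coeff_swapVars]

lemma swapVars_toSlicePoly (I : ImaginaryUnit) (p : ℝ[X][X]) :
    swapVars (toSlicePoly I p) = toSlicePoly I (swapVars p) :=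
  poly₂_ext fun n m => by simp only [coeff_toSlicePoly, coeff_swapVars]

end SliceRegular

end

theorem mainTheorem5 (P Q : SliceRegular.Poly₂ ℍ[ℝ]) :
    (SliceRegular.regResultant₁ P Q = 0 →
      ∀ I : SliceRegular.ImaginaryUnit, ∃ D : SliceRegular.Poly₂ (SliceRegular.slice I),
        0 < SliceRegular.degQ₁ D ∧
        SliceRegular.IsFactorOnSlice I D (SliceRegular.symmetrization P) ∧
        SliceRegular.IsFactorOnSlice I D (SliceRegular.symmetrization Q)) ∧
    (SliceRegular.regResultant₂ P Q = 0 →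
      ∀ I : SliceRegular.ImaginaryUnit, ∃ D : SliceRegular.Poly₂ (SliceRegular.slice I),
        0 < SliceRegular.degQ₂ D ∧
        SliceRegular.IsFactorOnSlice I D (SliceRegular.symmetrization P) ∧
        SliceRegular.IsFactorOnSlice I D (SliceRegular.symmetrization Q)) := by
  refine ⟨fun h I => ?_, fun h I => ?_⟩
  · obtain ⟨d, p, q, hd, hdp, hdq, hp, hq⟩ := SliceRegular.exists_real_common_factor h
    refine ⟨SliceRegular.toSlicePoly I d, ?_, SliceRegular.isFactorOnSlice_of_dvd I hdp hp,
      SliceRegular.isFactorOnSlice_of_dvd I hdq hq⟩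
    rwa [SliceRegular.degQ₁, SliceRegular.natDegree_toSlicePoly]
  -- By definition, `regResultant₂ P Q` is `regResultant₁` of the swapped polynomials; the factor
  -- found is then swapped back.
  · obtain ⟨d, p, q, hd, hdp, hdq, hp, hq⟩ := SliceRegular.exists_real_common_factor
      (P := SliceRegular.swapVars P) (Q := SliceRegular.swapVars Q) h
    refine ⟨SliceRegular.toSlicePoly I (SliceRegular.swapVars d), ?_,
      SliceRegular.isFactorOnSlice_of_dvd I (SliceRegular.swapVars_dvd hdp) ?_,
      SliceRegular.isFactorOnSlice_of_dvd I (SliceRegular.swapVars_dvd hdq) ?_⟩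
    · rwa [SliceRegular.degQ₂, SliceRegular.swapVars_toSlicePoly, SliceRegular.swapVars_swapVars,
        SliceRegular.natDegree_toSlicePoly]
    · rw [SliceRegular.ofRealPoly_swapVars, hp, SliceRegular.swapVars_symmetrization]
    · rw [SliceRegular.ofRealPoly_swapVars, hq, SliceRegular.swapVars_symmetrization]
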